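/- Let $G$ be a locally compact second countable Hausdorff topological group. A \emph{normal factor} $K/L$ of $G$ is given by closed normal subgroups $L<K$ of $G$; it is a \emph{chief factor} if no closed normal subgroup of $G$ lies strictly between $L$ and $K$. Normal factors $K_1/L_1$ and $K_2/L_2$ are \emph{associated} if $\overline{K_1L_2}=\overline{K_2L_1}$ and $K_i\cap\overline{L_1L_2}=L_i$ for $i=1,2$. A chief factor is \emph{negligible} if it is abelian or associated to a compact or discrete chief factor of $G$. An \emph{essentially chief series} of $G$ is a finite series $\{1\}=G_0\le G_1\le\dots\le G_n=G$ of closed normal subgroups of $G$ such that each $G_{i+1}/G_i$ is compact, discrete, or a chief factor of $G$. Theorem. Suppose that $G$ has two essentially chief series $(A_i)_{i=0}^m$ and $(B_j)_{j=0}^n$. Define $$I=\{i\in\{1,\dots,m\} : A_i/A_{i-1}\text{ is a non-negligible chief factor of }G\},$$ $$J=\{j\in\{1,\dots,n\} : B_j/B_{j-1}\text{ is a non-negligible chief factor of }G\}.$$ Then there is a bijection $f:I\to J$ such that, for each $i\in I$, $f(i)$ is the unique element $j\in J$ for which $A_i/A_{i-1}$ is associated to $B_j/B_{j-1}$. -/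

import Mathlib

open scoped Pointwise

namespace ChiefSeries

variable {G : Type*} [Group G] [TopologicalSpace G]

/-- `K/L` is a normal factor of `G`: `K` and `L` are closed normal subgroups with `L < K`. -/
structure IsNormalFactor (K L : Subgroup G) : Prop where
  normal_upper : K.Normal
  normal_lower : L.Normal
  closed_upper : IsClosed (K : Set G)
  closed_lower : IsClosed (L : Set G)
  lt : L < K

/-- `K/L` is a (topological) chief factor of `G`: a normal factor such that no closed normal
subgroup of `G` lies strictly between `L` and `K`. -/
structure IsChiefFactor (K L : Subgroup G) : Prop extends IsNormalFactor K L where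
  no_between : ¬ ∃ M : Subgroup G, M.Normal ∧ IsClosed (M : Set G) ∧ L < M ∧ M < K

/-- The quotient `K/L`, for `L ≤ K`. It carries the quotient topology of the subspace
topology of `K`. -/
abbrev Factor (K L : Subgroup G) : Type _ := K ⧸ L.subgroupOf K

/-- The factor `K/L` is compact. -/
def IsCompactFactor (K L : Subgroup G) : Prop := CompactSpace (Factor K L)

/-- The factor `K/L` is discrete. -/
def IsDiscreteFactor (K L : Subgroup G) : Prop := DiscreteTopology (Factor K L)

/-- The factor `K/L` is abelian: `(xL)(yL) = (yL)(xL)` in `K/L` for all `x`, `y` in `K`. -/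
def IsAbelianFactor (K L : Subgroup G) : Prop :=
  ∀ x y : K, ((x * y : K) : Factor K L) = ((y * x : K) : Factor K L)

/-- The normal factors `K₁/L₁` and `K₂/L₂` are associated. The products and closures
are those of subsets of `G`. -/
structure AreAssociated (K₁ L₁ K₂ L₂ : Subgroup G) : Prop where
  closure_eq : closure ((K₁ : Set G) * (L₂ : Set G)) = closure ((K₂ : Set G) * (L₁ : Set G))
  inter_left : (K₁ : Set G) ∩ closure ((L₁ : Set G) * (L₂ : Set G)) = L₁
  inter_right : (K₂ : Set G) ∩ closure ((L₁ : Set G) * (L₂ : Set G)) = L₂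

/-- A chief factor `K/L` is negligible if it is abelian or associated to a compact or discrete
chief factor of `G`. -/
def IsNegligible (K L : Subgroup G) : Prop :=
  IsAbelianFactor K L ∨
    ∃ K' L' : Subgroup G, IsChiefFactor K' L' ∧
      (IsCompactFactor K' L' ∨ IsDiscreteFactor K' L') ∧ AreAssociated K L K' L'

/-- `{1} = A₀ ≤ A₁ ≤ ⋯ ≤ Aₙ = G` is an essentially chief series of `G`: a finite series of closed
normal subgroups each of whose factors is compact, discrete, or a chief factor of `G`. -/
structure IsEssentiallyChiefSeries {n : ℕ} (A : Fin (n + 1) → Subgroup G) : Prop where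
  bot : A 0 = ⊥
  top : A (Fin.last n) = ⊤
  normal : ∀ i, (A i).Normal
  closed : ∀ i, IsClosed (A i : Set G)
  le_succ : ∀ i : Fin n, A i.castSucc ≤ A i.succ
  factor : ∀ i : Fin n,
    IsCompactFactor (A i.succ) (A i.castSucc) ∨
    IsDiscreteFactor (A i.succ) (A i.castSucc) ∨
    IsChiefFactor (A i.succ) (A i.castSucc)

/-- The positions of the non-negligible chief factors of a series. The element `i` of `Fin n`
stands for the factor `Aᵢ₊₁/Aᵢ`. -/
def nonNegligiblePositions {n : ℕ} (A : Fin (n + 1) → Subgroup G) : Set (Fin n) :=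
  {i | IsChiefFactor (A i.succ) (A i.castSucc) ∧ ¬ IsNegligible (A i.succ) (A i.castSucc)}

end ChiefSeries

/-!
The association class of a non-abelian chief factor `K/L` is determined by its centralizer
`C = {g | [g, K] ⊆ L}`, a closed normal subgroup of `G` with `K ∩ C = L`
(`centralizer_eq_of_associated`, `associated_of_centralizer_eq`). Given a series of closed normal
subgroups from `1` to `G`, there is exactly one step `N ≤ M` of the series with `N ≤ C` and
`M ≰ C`, and the factor associated to `K/L` has to be found there.

The key point is that `M/N` has a subfactor which is a chief factor associated to `K/L`. Put
`N' = M ∩ C` and let `P` be the closure of `N'[K, M]`. Let `R` be a closed normal subgroup of `G`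
with `N' < R ≤ M`. Then `R ≰ C`, and since `K/L` is a chief factor, `(R ∩ K)L` is dense in `K`
(`le_closure_of_not_le_centralizer`). For `x ∈ M` the set of `g` with `[g, x] ∈ R` is closed and
contains `(R ∩ K)L`, hence contains `K`. So `[K, M] ≤ R`, and therefore `P ≤ R`. Thus `P/N'` is a
chief factor (`isChiefFactor_coveringSubgroup`); it has centralizer `C`, because
`(K ∩ P)L` and `(K ∩ P)N'` are dense in `K` and in `P` (`centralizer_eq_of_covers`).

If `M/N` is compact or discrete, then so is `P/N'`, and `K/L` is negligible. If `M/N` is a chief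
factor, then it is itself associated to `K/L`. This gives the map from one series to the other;
it is bijective because both positions are determined by the centralizer.
-/

namespace ChiefSeries

open scoped commutatorElement

/-! ### Centralizers of normal factors -/

section Centralizer

variable {G : Type*} [Group G]

/-- The centralizer in `G` of the factor `K/L`: the elements `g` with `[g, k] ∈ L` for all
`k ∈ K`. It is a subgroup because `L` is normal. -/
def factorCentralizer (K L : Subgroup G) [hL : L.Normal] : Subgroup G where
  carrier := {g | ∀ k ∈ K, ⁅g, k⁆ ∈ L}
  one_mem' := fun k _ => by simp [L.one_mem]
  mul_mem' := fun {a b} ha hb k hk => by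
    have e : ⁅a * b, k⁆ = a * ⁅b, k⁆ * a⁻¹ * ⁅a, k⁆ := by
      simp only [commutatorElement_def]; group
    rw [e]
    exact L.mul_mem (hL.conj_mem _ (hb k hk) a) (ha k hk)
  inv_mem' := fun {a} ha k hk => by
    have e : ⁅a⁻¹, k⁆ = a⁻¹ * ⁅a, k⁆⁻¹ * a⁻¹⁻¹ := by
      simp only [commutatorElement_def]; group
    rw [e]
    exact hL.conj_mem _ (L.inv_mem (ha k hk)) a⁻¹

theorem mem_factorCentralizer {K L : Subgroup G} [L.Normal] {g : G} :
    g ∈ factorCentralizer K L ↔ ∀ k ∈ K, ⁅g, k⁆ ∈ L := Iff.rfl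

theorem commutator_mem_left {K : Subgroup G} [hK : K.Normal] {k : G} (hk : k ∈ K) (g : G) :
    ⁅k, g⁆ ∈ K := by
  rw [commutatorElement_def, mul_assoc, mul_assoc, ← mul_assoc g]
  exact K.mul_mem hk (hK.conj_mem _ (K.inv_mem hk) g)

theorem commutator_mem_right {K : Subgroup G} [hK : K.Normal] {k : G} (hk : k ∈ K) (g : G) :
    ⁅g, k⁆ ∈ K := by
  rw [commutatorElement_def]
  exact K.mul_mem (hK.conj_mem _ hk g) (K.inv_mem hk)

instance factorCentralizer_normal (K L : Subgroup G) [hK : K.Normal] [hL : L.Normal] :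
    (factorCentralizer K L).Normal where
  conj_mem a ha g k hk := by
    have e : ⁅g * a * g⁻¹, k⁆ = g * ⁅a, g⁻¹ * k * g⁻¹⁻¹⁆ * g⁻¹ := by
      simp only [commutatorElement_def]; group
    rw [e]
    exact hL.conj_mem _ (ha _ (hK.conj_mem k hk g⁻¹)) g

theorem lower_le_factorCentralizer (K L : Subgroup G) [L.Normal] :
    L ≤ factorCentralizer K L := fun _ hg k _ => commutator_mem_left hg k

/-- Normal subgroups whose intersection lies in `L` commute modulo `L`. -/
theorem le_factorCentralizer_of_inf_le {R K L : Subgroup G} [R.Normal] [K.Normal] [L.Normal]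
    (h : R ⊓ K ≤ L) : R ≤ factorCentralizer K L := fun _ hr k hk =>
  h ⟨commutator_mem_left hr k, commutator_mem_right hk _⟩

theorem isAbelianFactor_iff {K L : Subgroup G} [L.Normal] :
    IsAbelianFactor K L ↔ K ≤ factorCentralizer K L := by
  have key : ∀ x y : K, ((x * y : K) : Factor K L) = ((y * x : K) : Factor K L) ↔
      ⁅((y⁻¹ : K) : G), ((x⁻¹ : K) : G)⁆ ∈ L := fun x y => by
    rw [QuotientGroup.eq, Subgroup.mem_subgroupOf]
    simp [commutatorElement_def, mul_assoc]
  constructor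
  · intro h x hx y hy
    simpa using (key ⟨y, hy⟩⁻¹ ⟨x, hx⟩⁻¹).1 (h _ _)
  · intro h x y
    exact (key x y).2 (h (y⁻¹).2 _ (x⁻¹).2)

theorem commutator_mem_sup {S T L : Subgroup G} [T.Normal] [hL : L.Normal] {g : G}
    (hS : ∀ s ∈ S, ⁅g, s⁆ ∈ L) (hT : ∀ t ∈ T, ⁅g, t⁆ ∈ L) : ∀ k ∈ S ⊔ T, ⁅g, k⁆ ∈ L := by
  intro k hk
  obtain ⟨s, hs, t, ht, rfl⟩ := Subgroup.mem_sup_of_normal_right.1 hk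
  have e : ⁅g, s * t⁆ = ⁅g, s⁆ * (s * ⁅g, t⁆ * s⁻¹) := by
    simp only [commutatorElement_def]; group
  rw [e]
  exact L.mul_mem (hS s hs) (hL.conj_mem _ (hT t ht) s)

variable [TopologicalSpace G] [IsTopologicalGroup G]

theorem isClosed_factorCentralizer {K L : Subgroup G} [L.Normal] (hL : IsClosed (L : Set G)) :
    IsClosed (factorCentralizer K L : Set G) := by
  have e : (factorCentralizer K L : Set G) = ⋂ k ∈ K, (fun g : G => ⁅g, k⁆) ⁻¹' L := by
    ext g; simp [mem_factorCentralizer]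
  rw [e]
  refine isClosed_biInter fun k _ => hL.preimage ?_
  simp only [commutatorElement_def]
  fun_prop

theorem commutator_mem_of_mem_closure {S L : Subgroup G} (hLc : IsClosed (L : Set G)) {g : G}
    (h : ∀ s ∈ S, ⁅g, s⁆ ∈ L) {k : G} (hk : k ∈ S.topologicalClosure) : ⁅g, k⁆ ∈ L := by
  have hcl : IsClosed {k : G | ⁅g, k⁆ ∈ L} := by
    refine hLc.preimage (f := fun k : G => ⁅g, k⁆) ?_
    simp only [commutatorElement_def]
    fun_prop
  exact closure_minimal (s := (S : Set G)) h hcl hk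

end Centralizer

/-! ### Chief factors and their centralizers -/

section Chief

variable {G : Type*} [Group G] [TopologicalSpace G]

/-- A closed normal subgroup between `L` and `K` which is not below `L` is all of `K`. -/
theorem IsChiefFactor.le_of_not_le {K L M : Subgroup G} (h : IsChiefFactor K L) (hM : M.Normal)
    (hc : IsClosed (M : Set G)) (hLM : L ≤ M) (hMK : M ≤ K) (hn : ¬ M ≤ L) : K ≤ M := by
  by_contra hK
  exact h.no_between ⟨M, hM, hc, lt_of_le_not_ge hLM hn, lt_of_le_not_ge hMK hK⟩

/-- Applied to `C = C_G(K/L)`, this says that a non-abelian chief factor has trivial centre. -/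
theorem IsChiefFactor.inf_le {K L C : Subgroup G} (h : IsChiefFactor K L) [hC : C.Normal]
    (hCc : IsClosed (C : Set G)) (hLC : L ≤ C) (hn : ¬ K ≤ C) : K ⊓ C ≤ L := by
  have := h.normal_upper
  by_contra hle
  refine hn ((h.le_of_not_le (M := K ⊓ C) inferInstance ?_ (le_inf h.lt.le hLC) inf_le_left
    hle).trans inf_le_right)
  rw [Subgroup.coe_inf]
  exact h.closed_upper.inter hCc

theorem AreAssociated.symm {K₁ L₁ K₂ L₂ : Subgroup G} [L₁.Normal] (h : AreAssociated K₁ L₁ K₂ L₂) :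
    AreAssociated K₂ L₂ K₁ L₁ where
  closure_eq := h.closure_eq.symm
  inter_left := by rw [Subgroup.set_mul_normal_comm]; exact h.inter_right
  inter_right := by rw [Subgroup.set_mul_normal_comm]; exact h.inter_left

variable [IsTopologicalGroup G]

theorem IsChiefFactor.le_closure {K L R : Subgroup G} (h : IsChiefFactor K L) [R.Normal]
    (hR : ¬ R ⊓ K ≤ L) : K ≤ ((R ⊓ K) ⊔ L).topologicalClosure := by
  have := h.normal_upper
  have := h.normal_lower
  refine h.le_of_not_le (Subgroup.is_normal_topologicalClosure _)
    (Subgroup.isClosed_topologicalClosure _)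
    (le_sup_right.trans (Subgroup.le_topologicalClosure _))
    (Subgroup.topologicalClosure_minimal _ (sup_le inf_le_right h.lt.le) h.closed_upper)
    fun hle => hR (le_sup_left.trans ((Subgroup.le_topologicalClosure _).trans hle))

theorem le_closure_of_not_le_centralizer {K L R : Subgroup G} [K.Normal] [L.Normal] [R.Normal]
    (h : IsChiefFactor K L) (hR : ¬ R ≤ factorCentralizer K L) :
    K ≤ ((R ⊓ K) ⊔ L).topologicalClosure :=
  h.le_closure fun hle => hR (le_factorCentralizer_of_inf_le hle)

/-- If a chief factor `M/N` covers the non-abelian chief factor `K/L`, in the sense that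
`N ≤ C_G(K/L)` but `M ≰ C_G(K/L)`, then both have the same centralizer: the subgroup `K ∩ M` is
dense in both factors. -/
theorem centralizer_eq_of_covers {K L M N : Subgroup G} [K.Normal] [L.Normal] [M.Normal]
    [N.Normal] (h : IsChiefFactor K L) (h' : IsChiefFactor M N)
    (hK : ¬ K ≤ factorCentralizer K L) (hN : N ≤ factorCentralizer K L)
    (hM : ¬ M ≤ factorCentralizer K L) : factorCentralizer M N = factorCentralizer K L := by
  have hC := isClosed_factorCentralizer (K := K) h.closed_lower
  have hKC := h.inf_le hC (lower_le_factorCentralizer K L) hK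
  have hMC := h'.inf_le hC hN hM
  have dK := le_closure_of_not_le_centralizer h hM
  have dM : M ≤ ((K ⊓ M) ⊔ N).topologicalClosure := h'.le_closure fun hle =>
    hM (le_factorCentralizer_of_inf_le fun x hx => hKC ⟨hx.2, hN (hle ⟨hx.2, hx.1⟩)⟩)
  apply le_antisymm
  · intro g hg k hk
    refine commutator_mem_of_mem_closure h.closed_lower (commutator_mem_sup ?_ ?_) (dK hk)
    · exact fun s hs => hKC ⟨commutator_mem_right hs.2 g, hN (hg s hs.1)⟩
    · exact fun t ht => commutator_mem_right ht g
  · intro g hg k hk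
    refine commutator_mem_of_mem_closure h'.closed_lower (commutator_mem_sup ?_ ?_) (dM hk)
    · exact fun s hs => hMC ⟨commutator_mem_right hs.2 g,
        lower_le_factorCentralizer K L (hg s hs.1)⟩
    · exact fun t ht => commutator_mem_right ht g

/-! ### The chief factor inside a non-centralizing subgroup -/

/-- The closure of `N'[K, M]`, where `N' = M ∩ C_G(K/L)`. If `K/L` is a non-abelian chief factor
and `M` is a closed normal subgroup which does not centralize it, this is the least closed normal
subgroup `R` of `G` with `N' < R ≤ M`. -/
def coveringSubgroup (K L M : Subgroup G) [L.Normal] : Subgroup G :=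
  ((M ⊓ factorCentralizer K L) ⊔ ⁅K, M⁆).topologicalClosure

theorem coveringSubgroup_le {K L M : Subgroup G} [K.Normal] [L.Normal] [M.Normal]
    (hM : IsClosed (M : Set G)) : coveringSubgroup K L M ≤ M :=
  Subgroup.topologicalClosure_minimal _ (sup_le inf_le_left (Subgroup.commutator_le_right _ _)) hM

theorem inf_le_coveringSubgroup (K L M : Subgroup G) [L.Normal] :
    M ⊓ factorCentralizer K L ≤ coveringSubgroup K L M :=
  le_sup_left.trans (Subgroup.le_topologicalClosure _)

theorem coveringSubgroup_le_of_not_le {K L M R : Subgroup G} [K.Normal] [L.Normal] [M.Normal]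
    [hR : R.Normal] (h : IsChiefFactor K L) (hRc : IsClosed (R : Set G))
    (hle : M ⊓ factorCentralizer K L ≤ R) (hn : ¬ R ≤ factorCentralizer K L) :
    coveringSubgroup K L M ≤ R := by
  refine Subgroup.topologicalClosure_minimal _ (sup_le hle ?_) hRc
  rw [Subgroup.commutator_comm, Subgroup.commutator_le]
  intro x hx k hk
  refine commutator_mem_of_mem_closure hRc (commutator_mem_sup ?_ ?_)
    (le_closure_of_not_le_centralizer h hn hk)
  · exact fun s hs => commutator_mem_right hs.1 x
  · exact fun t ht => hle ⟨commutator_mem_left hx t,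
      lower_le_factorCentralizer K L (commutator_mem_right ht x)⟩

theorem not_coveringSubgroup_le {K L M : Subgroup G} [K.Normal] [L.Normal] [M.Normal]
    (h : IsChiefFactor K L) (hK : ¬ K ≤ factorCentralizer K L)
    (hM : ¬ M ≤ factorCentralizer K L) :
    ¬ coveringSubgroup K L M ≤ factorCentralizer K L := by
  intro hle
  have hC := isClosed_factorCentralizer (K := K) h.closed_lower
  have hKC := h.inf_le hC (lower_le_factorCentralizer K L) hK
  refine hM fun x hx k hk => hKC ⟨commutator_mem_right hk x, hle ?_⟩
  refine Subgroup.le_topologicalClosure _ (Subgroup.mem_sup_right ?_)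
  rw [Subgroup.commutator_comm]
  exact Subgroup.commutator_mem_commutator hx hk

theorem isChiefFactor_coveringSubgroup {K L M : Subgroup G} [K.Normal] [L.Normal] [M.Normal]
    (h : IsChiefFactor K L) (hK : ¬ K ≤ factorCentralizer K L)
    (hMc : IsClosed (M : Set G)) (hM : ¬ M ≤ factorCentralizer K L) :
    IsChiefFactor (coveringSubgroup K L M) (M ⊓ factorCentralizer K L) where
  normal_upper := Subgroup.is_normal_topologicalClosure _
  normal_lower := inferInstance
  closed_upper := Subgroup.isClosed_topologicalClosure _
  closed_lower := by
    rw [Subgroup.coe_inf]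
    exact hMc.inter (isClosed_factorCentralizer h.closed_lower)
  lt := lt_of_le_not_ge (inf_le_coveringSubgroup K L M) fun hle =>
    not_coveringSubgroup_le h hK hM (hle.trans inf_le_right)
  no_between := by
    rintro ⟨R, hR, hRc, hlt, hlt'⟩
    exact hlt'.not_ge (coveringSubgroup_le_of_not_le h hRc hlt.le fun hle =>
      hlt.not_ge (le_inf (hlt'.le.trans (coveringSubgroup_le hMc)) hle))

/-! ### Association -/

theorem AreAssociated.upper_le {K₁ L₁ K₂ L₂ : Subgroup G} [L₁.Normal] [L₂.Normal]
    (h : AreAssociated K₁ L₁ K₂ L₂) : K₂ ≤ (K₁ ⊔ L₂).topologicalClosure := by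
  intro x hx
  rw [← SetLike.mem_coe, Subgroup.topologicalClosure_coe, Subgroup.mul_normal, h.closure_eq]
  exact subset_closure ⟨x, hx, 1, L₁.one_mem, mul_one x⟩

theorem AreAssociated.inf_closure_le {K₁ L₁ K₂ L₂ : Subgroup G} [L₂.Normal]
    (h : AreAssociated K₁ L₁ K₂ L₂) : K₂ ⊓ (L₁ ⊔ L₂).topologicalClosure ≤ L₂ := by
  rw [← SetLike.coe_subset_coe, Subgroup.coe_inf, Subgroup.topologicalClosure_coe,
    Subgroup.mul_normal, h.inter_right]

theorem AreAssociated.factorCentralizer_le {K₁ L₁ K₂ L₂ : Subgroup G} [K₂.Normal] [L₁.Normal]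
    [L₂.Normal] (h : AreAssociated K₁ L₁ K₂ L₂) :
    factorCentralizer K₁ L₁ ≤ factorCentralizer K₂ L₂ := by
  intro g hg k hk
  have := Subgroup.is_normal_topologicalClosure (L₁ ⊔ L₂)
  refine h.inf_closure_le ⟨commutator_mem_right hk g, ?_⟩
  refine commutator_mem_of_mem_closure (Subgroup.isClosed_topologicalClosure _)
    (commutator_mem_sup ?_ ?_) (h.upper_le hk)
  · exact fun s hs => Subgroup.le_topologicalClosure _ (Subgroup.mem_sup_left (hg s hs))
  · exact fun t ht => Subgroup.le_topologicalClosure _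
      (Subgroup.mem_sup_right (commutator_mem_right ht g))

theorem centralizer_eq_of_associated {K₁ L₁ K₂ L₂ : Subgroup G} [K₁.Normal] [K₂.Normal]
    [L₁.Normal] [L₂.Normal] (h : AreAssociated K₁ L₁ K₂ L₂) :
    factorCentralizer K₁ L₁ = factorCentralizer K₂ L₂ :=
  le_antisymm h.factorCentralizer_le h.symm.factorCentralizer_le

/-- Being non-abelian is invariant under association. -/
theorem AreAssociated.not_le_factorCentralizer {K₁ L₁ K₂ L₂ : Subgroup G} [K₁.Normal] [K₂.Normal]
    [L₁.Normal] [L₂.Normal] (h : AreAssociated K₁ L₁ K₂ L₂) (hL : IsClosed (L₁ : Set G))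
    (hK : ¬ K₁ ≤ factorCentralizer K₁ L₁) : ¬ K₂ ≤ factorCentralizer K₂ L₂ := by
  intro hle
  rw [← centralizer_eq_of_associated h] at hle
  exact hK (h.symm.upper_le.trans (Subgroup.topologicalClosure_minimal _
    (sup_le hle (lower_le_factorCentralizer K₁ L₁)) (isClosed_factorCentralizer hL)))

/-- Since `K₁` does not centralize the chief factor `K₂/L₂`, already `(K₁ ∩ K₂)L₂` is dense in
`K₂`. -/
theorem upper_le_closure_of_centralizer_eq {K₁ L₁ K₂ L₂ : Subgroup G} [K₁.Normal] [K₂.Normal]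
    [L₁.Normal] [L₂.Normal] (h₂ : IsChiefFactor K₂ L₂)
    (hK : ¬ K₁ ≤ factorCentralizer K₁ L₁)
    (e : factorCentralizer K₁ L₁ = factorCentralizer K₂ L₂) :
    K₂ ≤ (K₁ ⊔ L₂).topologicalClosure := by
  rw [e] at hK
  exact (le_closure_of_not_le_centralizer h₂ hK).trans
    (Subgroup.topologicalClosure_mono (sup_le_sup_right inf_le_left _))

theorem associated_of_centralizer_eq {K₁ L₁ K₂ L₂ : Subgroup G} [K₁.Normal] [K₂.Normal]
    [L₁.Normal] [L₂.Normal] (h₁ : IsChiefFactor K₁ L₁) (h₂ : IsChiefFactor K₂ L₂)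
    (hK₁ : ¬ K₁ ≤ factorCentralizer K₁ L₁) (hK₂ : ¬ K₂ ≤ factorCentralizer K₂ L₂)
    (e : factorCentralizer K₁ L₁ = factorCentralizer K₂ L₂) : AreAssociated K₁ L₁ K₂ L₂ := by
  have hC₁ := isClosed_factorCentralizer (K := K₁) h₁.closed_lower
  have l₁ := lower_le_factorCentralizer K₁ L₁
  have l₂ := lower_le_factorCentralizer K₂ L₂
  have hL : (L₁ ⊔ L₂).topologicalClosure ≤ factorCentralizer K₁ L₁ :=
    Subgroup.topologicalClosure_minimal _ (sup_le l₁ (e ▸ l₂)) hC₁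
  have i₁ : K₁ ⊓ (L₁ ⊔ L₂).topologicalClosure = L₁ :=
    le_antisymm ((inf_le_inf_left _ hL).trans (h₁.inf_le hC₁ l₁ hK₁))
      (le_inf h₁.lt.le (le_sup_left.trans (Subgroup.le_topologicalClosure _)))
  have i₂ : K₂ ⊓ (L₁ ⊔ L₂).topologicalClosure = L₂ :=
    le_antisymm ((inf_le_inf_left _ hL).trans (h₂.inf_le hC₁ (e ▸ l₂) (e ▸ hK₂)))
      (le_inf h₂.lt.le (le_sup_right.trans (Subgroup.le_topologicalClosure _)))
  have c : (K₁ ⊔ L₂).topologicalClosure = (K₂ ⊔ L₁).topologicalClosure :=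
    le_antisymm
      (Subgroup.topologicalClosure_minimal _
        (sup_le (upper_le_closure_of_centralizer_eq h₁ hK₂ e.symm)
          (h₂.lt.le.trans (le_sup_left.trans (Subgroup.le_topologicalClosure _))))
        (Subgroup.isClosed_topologicalClosure _))
      (Subgroup.topologicalClosure_minimal _
        (sup_le (upper_le_closure_of_centralizer_eq h₂ hK₁ e)
          (h₁.lt.le.trans (le_sup_left.trans (Subgroup.le_topologicalClosure _))))
        (Subgroup.isClosed_topologicalClosure _))
  constructor
  · simpa only [Subgroup.topologicalClosure_coe, Subgroup.mul_normal] using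
      congrArg (SetLike.coe : Subgroup G → Set G) c
  · simpa only [Subgroup.coe_inf, Subgroup.topologicalClosure_coe, Subgroup.mul_normal] using
      congrArg (SetLike.coe : Subgroup G → Set G) i₁
  · simpa only [Subgroup.coe_inf, Subgroup.topologicalClosure_coe, Subgroup.mul_normal] using
      congrArg (SetLike.coe : Subgroup G → Set G) i₂

/-! ### Compact and discrete factors -/

omit [IsTopologicalGroup G] in
/-- The inclusion `P/N → M/N` is a closed embedding if `P` is closed: a closed subset of `P/N` and
its image in `M/N` have the same preimage as subsets of `G`, because `N ≤ P`. -/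
theorem isClosedEmbedding_factor {M N P : Subgroup G} (hP : IsClosed (P : Set G)) (hNP : N ≤ P)
    (hPM : P ≤ M) :
    Topology.IsClosedEmbedding (Subgroup.quotientSubgroupOfEmbeddingOfLE N hPM) := by
  have hi : Topology.IsClosedEmbedding (Subgroup.inclusion hPM) := by
    refine ⟨Topology.IsEmbedding.inclusion hPM, ?_⟩
    have e : Set.range (Subgroup.inclusion hPM) = ((↑) : M → G) ⁻¹' (P : Set G) :=
      Set.range_inclusion hPM
    rw [e]
    exact hP.preimage continuous_subtype_val
  refine .of_continuous_injective_isClosedMap ?_ (Function.Embedding.injective _) ?_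
  · rw [(QuotientGroup.isQuotientMap_mk _).continuous_iff]
    exact QuotientGroup.continuous_mk.comp hi.continuous
  · intro Z hZ
    rw [← (QuotientGroup.isQuotientMap_mk _).isClosed_preimage]
    have e : (QuotientGroup.mk : M → Factor M N) ⁻¹'
          (Subgroup.quotientSubgroupOfEmbeddingOfLE N hPM '' Z) =
        Subgroup.inclusion hPM '' ((QuotientGroup.mk : P → Factor P N) ⁻¹' Z) := by
      ext x
      constructor
      · rintro ⟨z, hz, hzx⟩
        obtain ⟨p, rfl⟩ := QuotientGroup.mk_surjective z
        rw [Subgroup.quotientSubgroupOfEmbeddingOfLE_apply_mk, QuotientGroup.eq,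
          Subgroup.mem_subgroupOf] at hzx
        have hx : (p : G)⁻¹ * x ∈ N := hzx
        have hxP : (x : G) ∈ P := by simpa using P.mul_mem p.2 (hNP hx)
        refine ⟨⟨x, hxP⟩, ?_, rfl⟩
        have hpx' : ((p⁻¹ * ⟨x, hxP⟩ : P) : G) ∈ N := hx
        have hpx : ((⟨x, hxP⟩ : P) : Factor P N) = (p : Factor P N) :=
          (QuotientGroup.eq.2 (Subgroup.mem_subgroupOf.2 hpx')).symm
        rwa [Set.mem_preimage, hpx]
      · rintro ⟨p, hp, rfl⟩
        exact ⟨p, hp, rfl⟩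
    rw [e]
    exact hi.isClosedMap _ (hZ.preimage QuotientGroup.continuous_mk)

omit [IsTopologicalGroup G] in
/-- Closed subfactors of compact factors are compact. -/
theorem IsCompactFactor.of_le {M N P Q : Subgroup G} (h : IsCompactFactor M N) (hNQ : N ≤ Q)
    (hQP : Q ≤ P) (hPM : P ≤ M) (hP : IsClosed (P : Set G)) : IsCompactFactor P Q := by
  have : CompactSpace (Factor M N) := h
  have : CompactSpace (Factor M Q) := by
    refine Function.Surjective.compactSpace
      (f := Subgroup.quotientMapOfLE (s := N.subgroupOf M)
      (t := Q.subgroupOf M) (Subgroup.comap_mono hNQ)) ?_ ?_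
    · rw [(QuotientGroup.isQuotientMap_mk _).continuous_iff]
      exact QuotientGroup.continuous_mk
    · intro x
      obtain ⟨x, rfl⟩ := QuotientGroup.mk_surjective x
      exact ⟨QuotientGroup.mk x, rfl⟩
  exact (isClosedEmbedding_factor hP hQP hPM).compactSpace

/-- Subfactors of discrete factors are discrete. -/
theorem IsDiscreteFactor.of_le {M N P Q : Subgroup G} (h : IsDiscreteFactor M N) (hNQ : N ≤ Q)
    (hPM : P ≤ M) : IsDiscreteFactor P Q := by
  have h' := QuotientGroup.discreteTopology_iff.1 h
  refine QuotientGroup.discreteTopology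
    (Subgroup.isOpen_mono (H₁ := N.subgroupOf P) (Subgroup.comap_mono hNQ) ?_)
  exact h'.preimage (continuous_inclusion hPM)

/-! ### The covering step of a series -/

/-- If the step `M/N` of a series covers the non-negligible chief factor `K/L`, then `M/N` is a
chief factor, is not negligible, and is associated to `K/L`. -/
theorem associated_of_covers {K L M N : Subgroup G} [K.Normal] [L.Normal] [M.Normal] [N.Normal]
    (h : IsChiefFactor K L) (hneg : ¬ IsNegligible K L) (hMc : IsClosed (M : Set G)) (hNM : N ≤ M)
    (hN : N ≤ factorCentralizer K L) (hM : ¬ M ≤ factorCentralizer K L)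
    (hfac : IsCompactFactor M N ∨ IsDiscreteFactor M N ∨ IsChiefFactor M N) :
    IsChiefFactor M N ∧ ¬ IsNegligible M N ∧ AreAssociated K L M N := by
  have hK : ¬ K ≤ factorCentralizer K L := fun hle => hneg (.inl (isAbelianFactor_iff.2 hle))
  -- Every chief factor covering `K/L` is associated to it.
  have main : ∀ P Q : Subgroup G, IsChiefFactor P Q → Q ≤ factorCentralizer K L →
      ¬ P ≤ factorCentralizer K L → AreAssociated K L P Q := by
    intro P Q hc hQ hP
    have := hc.normal_upper
    have := hc.normal_lower
    have e := centralizer_eq_of_covers h hc hK hQ hP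
    exact associated_of_centralizer_eq h hc hK (e ▸ hP) e.symm
  have hP := isChiefFactor_coveringSubgroup h hK hMc hM
  have hPa := main _ _ hP inf_le_right (not_coveringSubgroup_le h hK hM)
  have hNQ : N ≤ M ⊓ factorCentralizer K L := le_inf hNM hN
  have hPM : coveringSubgroup K L M ≤ M := coveringSubgroup_le hMc
  rcases hfac with hf | hf | hf
  · exact absurd (.inr ⟨_, _, hP, .inl (hf.of_le hNQ hP.lt.le hPM hP.closed_upper), hPa⟩) hneg
  · exact absurd (.inr ⟨_, _, hP, .inr (hf.of_le hNQ hPM), hPa⟩) hneg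
  · have ha := main _ _ hf hN hM
    have e := centralizer_eq_of_associated ha
    have hM' : ¬ M ≤ factorCentralizer M N := e ▸ hM
    refine ⟨hf, ?_, ha⟩
    rintro (hab | ⟨K', L', hc, hcd, ha'⟩)
    · exact hM' (isAbelianFactor_iff.1 hab)
    · -- Association is transitive here, since it means equality of centralizers.
      have := hc.normal_upper
      have := hc.normal_lower
      exact hneg (.inr ⟨K', L', hc, hcd, associated_of_centralizer_eq h hc hK
        (ha'.not_le_factorCentralizer hf.closed_lower hM')
        (e.trans (centralizer_eq_of_associated ha'))⟩)

omit [IsTopologicalGroup G] in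
theorem IsEssentiallyChiefSeries.exists_step {n : ℕ} {B : Fin (n + 1) → Subgroup G}
    (hB : IsEssentiallyChiefSeries B) {C : Subgroup G} (hC : C ≠ ⊤) :
    ∃ j : Fin n, B j.castSucc ≤ C ∧ ¬ B j.succ ≤ C := by
  by_contra! hno
  have hall : ∀ j, B j ≤ C := fun j => by
    induction j using Fin.induction with
    | zero => rw [hB.bot]; exact bot_le
    | succ j ih => exact hno j ih
  exact hC (top_le_iff.1 (hB.top ▸ hall (Fin.last n)))

omit [IsTopologicalGroup G] in
theorem IsEssentiallyChiefSeries.step_unique {n : ℕ} {B : Fin (n + 1) → Subgroup G}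
    (hB : IsEssentiallyChiefSeries B) {C : Subgroup G} {i j : Fin n}
    (hi : B i.castSucc ≤ C) (hi' : ¬ B i.succ ≤ C) (hj : B j.castSucc ≤ C)
    (hj' : ¬ B j.succ ≤ C) : i = j := by
  have hmono : Monotone B := Fin.monotone_iff_le_succ.2 hB.le_succ
  rcases lt_trichotomy i j with hlt | heq | hlt
  · exact absurd ((hmono (Fin.succ_le_castSucc_iff.2 hlt)).trans hj) hi'
  · exact heq
  · exact absurd ((hmono (Fin.succ_le_castSucc_iff.2 hlt)).trans hi) hj'

theorem IsEssentiallyChiefSeries.exists_associated {n : ℕ} {B : Fin (n + 1) → Subgroup G}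
    (hB : IsEssentiallyChiefSeries B) {K L : Subgroup G} (h : IsChiefFactor K L)
    (hneg : ¬ IsNegligible K L) :
    ∃ j : nonNegligiblePositions B, AreAssociated K L (B j.1.succ) (B j.1.castSucc) := by
  have := h.normal_upper
  have := h.normal_lower
  have := hB.normal
  have hC : factorCentralizer K L ≠ ⊤ := fun e =>
    hneg (.inl (isAbelianFactor_iff.2 (e ▸ le_top)))
  obtain ⟨j, hj, hj'⟩ := hB.exists_step hC
  obtain ⟨h₁, h₂, h₃⟩ := associated_of_covers h hneg (hB.closed _) (hB.le_succ j) hj hj'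
    (hB.factor j)
  exact ⟨⟨j, h₁, h₂⟩, h₃⟩

theorem IsEssentiallyChiefSeries.eq_of_associated {n : ℕ} {B : Fin (n + 1) → Subgroup G}
    (hB : IsEssentiallyChiefSeries B) {K L : Subgroup G} [K.Normal] [L.Normal]
    {i j : nonNegligiblePositions B}
    (hi : AreAssociated K L (B i.1.succ) (B i.1.castSucc))
    (hj : AreAssociated K L (B j.1.succ) (B j.1.castSucc)) : i = j := by
  have := hB.normal
  -- A non-negligible position associated to `K/L` is a step at which the series leaves `C_G(K/L)`.
  have key : ∀ k : nonNegligiblePositions B,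
      AreAssociated K L (B k.1.succ) (B k.1.castSucc) →
      B k.1.castSucc ≤ factorCentralizer K L ∧ ¬ B k.1.succ ≤ factorCentralizer K L := by
    intro k hk
    rw [centralizer_eq_of_associated hk]
    exact ⟨lower_le_factorCentralizer _ _, fun hle => k.2.2 (.inl (isAbelianFactor_iff.2 hle))⟩
  exact Subtype.ext (hB.step_unique (key i hi).1 (key i hi).2 (key j hj).1 (key j hj).2)

end Chief

end ChiefSeries

theorem mainTheorem3 {G : Type*} [Group G] [TopologicalSpace G] [IsTopologicalGroup G]
    [T2Space G] [LocallyCompactSpace G] [SecondCountableTopology G]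
    {m n : ℕ} (A : Fin (m + 1) → Subgroup G) (B : Fin (n + 1) → Subgroup G)
    (hA : ChiefSeries.IsEssentiallyChiefSeries A)
    (hB : ChiefSeries.IsEssentiallyChiefSeries B) :
    ∃ f : ChiefSeries.nonNegligiblePositions A → ChiefSeries.nonNegligiblePositions B,
      Function.Bijective f ∧
      ∀ i : ChiefSeries.nonNegligiblePositions A,
        ChiefSeries.AreAssociated (A i.1.succ) (A i.1.castSucc)
          (B (f i).1.succ) (B (f i).1.castSucc) ∧
        ∀ j : ChiefSeries.nonNegligiblePositions B,
          ChiefSeries.AreAssociated (A i.1.succ) (A i.1.castSucc)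
            (B j.1.succ) (B j.1.castSucc) → j = f i := by
  have hAn := hA.normal
  have hBn := hB.normal
  choose f hf using fun i : ChiefSeries.nonNegligiblePositions A =>
    hB.exists_associated i.2.1 i.2.2
  refine ⟨f, ⟨fun i i' e => ?_, fun j => ?_⟩, fun i => ⟨hf i, fun j hj =>
    hB.eq_of_associated hj (hf i)⟩⟩
  · exact hA.eq_of_associated (hf i).symm (e ▸ (hf i').symm)
  · obtain ⟨i, hi⟩ := hA.exists_associated j.2.1 j.2.2
    exact ⟨i, hB.eq_of_associated (hf i) hi.symm⟩
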